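/- For a finite simple graph $G$ with vertex set $V$, let $\mathcal P_G\subset\mathbb R^V$ be its symmetric edge polytope, that is, the convex hull of the vectors $\pm(e_i-e_j)$ for the edges $\{i,j\}$ of $G$, and let $N(\mathcal P_G)$ be its number of facets. A graph $G$ is the $1$-sum of two graphs $G_1$ and $G_2$ having exactly one common vertex if $G$ is the union of $G_1$ and $G_2$; the $1$-sum of several graphs is defined by successively forming $1$-sums of two graphs (the $1$-sum of a single graph is that graph). Graphs are considered up to isomorphism. Say that a connected graph $G$ with $n$ vertices satisfies the condition of the Braun–Bruegge conjecture if either $n\le 2$ (where nothing is required), or $n\ge 3$ and the following hold. (1) If $n$ is odd, then $3\cdot 2^{\frac{n-1}{2}}-2\le N(\mathcal P_G)\le 6^{\frac{n-1}{2}}$; moreover, $N(\mathcal P_G)=3\cdot 2^{\frac{n-1}{2}}-2$ if and only if $G=K_{(n-1)/2,(n+1)/2}$, and $N(\mathcal P_G)=6^{\frac{n-1}{2}}$ if and only if $G$ is a $1$-sum of $(n-1)/2$ triangles. (2) If $n$ is even, then $2^{\frac n2+1}-2\le N(\mathcal P_G)\le 14\cdot 6^{\frac n2-2}$; moreover, $N(\mathcal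 P_G)=2^{\frac n2+1}-2$ if and only if $G=K_{n/2,n/2}$, and $N(\mathcal P_G)=14\cdot 6^{\frac n2-2}$ if and only if $G$ is a $1$-sum of $K_4$ with $\frac n2-2$ triangles. Let $G$ be the $1$-sum of connected graphs $G_1$ and $G_2$. If $G_1$ and $G_2$ satisfy the condition of the Braun–Bruegge conjecture, then so does $G$. -/

import Mathlib

/-- The symmetric edge polytope of `G`: the convex hull of all `e i - e j` with `i`, `j` adjacent.
Adjacency is symmetric, so both signs of every edge occur. -/
noncomputable def symmetricEdgePolytope {V : Type*} (G : SimpleGraph V) : Set (V → ℝ) :=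
  open Classical in
  convexHull ℝ {x | ∃ i j : V, G.Adj i j ∧ x = Pi.single i 1 - Pi.single j 1}

/-- A facet of a polytope `P` of dimension at least `1`: a nonempty (exposed) face of dimension
`dim P - 1`, where the dimension is that of the affine span. -/
def IsFacet {E : Type*} [AddCommGroup E] [Module ℝ E] [TopologicalSpace E]
    (P F : Set E) : Prop :=
  IsExposed ℝ P F ∧ F.Nonempty ∧
    Module.finrank ℝ (vectorSpan ℝ F) + 1 = Module.finrank ℝ (vectorSpan ℝ P)

/-- The number of facets of a polytope. -/
noncomputable def numFacets {E : Type*} [AddCommGroup E] [Module ℝ E] [TopologicalSpace E]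
    (P : Set E) : ℕ :=
  {F : Set E | IsFacet P F}.ncard

/-- `G` is (up to isomorphism) a 1-sum of `G₁` and `G₂`: copies of `G₁` and `G₂` that have exactly
one common vertex are embedded in the vertex set of `G`, and `G` is their union. -/
def IsOneSum {V V₁ V₂ : Type*} (G : SimpleGraph V) (G₁ : SimpleGraph V₁)
    (G₂ : SimpleGraph V₂) : Prop :=
  ∃ (f₁ : V₁ ↪ V) (f₂ : V₂ ↪ V),
    (∃ v : V, Set.range f₁ ∩ Set.range f₂ = {v}) ∧
    Set.range f₁ ∪ Set.range f₂ = Set.univ ∧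
    ∀ x y : V, G.Adj x y ↔
      (∃ a b : V₁, G₁.Adj a b ∧ f₁ a = x ∧ f₁ b = y) ∨
      (∃ a b : V₂, G₂.Adj a b ∧ f₂ a = x ∧ f₂ b = y)

/-- `IsOneSumOf s G`: the graph `G` is obtained from the members of the finite nonempty family `s`
(each used once, up to isomorphism) by successively forming 1-sums. -/
inductive IsOneSumOf.{u} :
    Multiset (Σ m : ℕ, SimpleGraph (Fin m)) → ∀ {V : Type u}, SimpleGraph V → Prop
  | single {V : Type u} (G : SimpleGraph V) (H : Σ m : ℕ, SimpleGraph (Fin m))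
      (e : Nonempty (G ≃g H.2)) : IsOneSumOf {H} G
  | oneSum {V V₁ V₂ : Type u} (G : SimpleGraph V) (G₁ : SimpleGraph V₁) (G₂ : SimpleGraph V₂)
      (s t : Multiset (Σ m : ℕ, SimpleGraph (Fin m)))
      (h₁ : IsOneSumOf s G₁) (h₂ : IsOneSumOf t G₂) (h : IsOneSum G G₁ G₂) :
      IsOneSumOf (s + t) G

/-- The complete graph on `m` vertices, as a member of a family of finite graphs. -/
def completeOn (m : ℕ) : Σ m : ℕ, SimpleGraph (Fin m) := ⟨m, ⊤⟩

/-- The assertion of the Braun–Bruegge conjecture for a graph `G` with finite vertex set, where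
`n` is the number of vertices and `N` the number of facets of the symmetric edge polytope.
The conjecture is about `n ≥ 3`; there, no subtraction or division below is truncated. -/
def SatisfiesBraunBruegge {V : Type*} (G : SimpleGraph V) : Prop :=
  let n := Nat.card V
  let N := numFacets (symmetricEdgePolytope G)
  3 ≤ n →
    (Odd n →
      3 * 2 ^ ((n - 1) / 2) - 2 ≤ N ∧ N ≤ 6 ^ ((n - 1) / 2) ∧
      (N = 3 * 2 ^ ((n - 1) / 2) - 2 ↔
        Nonempty (G ≃g completeBipartiteGraph (Fin ((n - 1) / 2)) (Fin ((n + 1) / 2)))) ∧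
      (N = 6 ^ ((n - 1) / 2) ↔
        IsOneSumOf (Multiset.replicate ((n - 1) / 2) (completeOn 3)) G)) ∧
    (Even n →
      2 ^ (n / 2 + 1) - 2 ≤ N ∧ N ≤ 14 * 6 ^ (n / 2 - 2) ∧
      (N = 2 ^ (n / 2 + 1) - 2 ↔
        Nonempty (G ≃g completeBipartiteGraph (Fin (n / 2)) (Fin (n / 2)))) ∧
      (N = 14 * 6 ^ (n / 2 - 2) ↔
        IsOneSumOf ({completeOn 4} + Multiset.replicate (n / 2 - 2) (completeOn 3)) G))

/-! Facets of the polytope of a connected graph on at least two vertices correspond to integer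
labelings of the vertices, up to a constant, that change by at most one along every edge and whose
edges of change exactly one form a connected spanning subgraph (`numFacets_symmetricEdgePolytope`).
A labeling of a 1-sum is a pair of labelings agreeing at the glued vertex, and its unit step
subgraph is the 1-sum of the two unit step subgraphs; hence the number of facets is multiplicative
(`OneSumData.ncard_facetLabelings`).

What remains is arithmetic in the parities of the two orders. Multiplying lower bounds gives a
strict inequality except for two copies of `K₂`, whose 1-sum is `K_{1,2}`. In the other cases the
complete bipartite graph in question is 2-connected, hence not a nontrivial 1-sum, so both sides of
the equivalence fail. The upper bounds either multiply exactly, so that equality passes to both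
factors and their decompositions combine, or multiply to something strictly smaller; then a
decomposition into triangles and `K₄` is excluded because `K₃` contributes 6 and `K₄` contributes
14. The conjecture is void on two vertices, so the value 2 for `K₂` enters separately, and a
one-vertex summand changes nothing. -/

/-- The edges of `G` along which the labeling `f` changes by exactly one. -/
def unitStepSubgraph {V : Type*} (G : SimpleGraph V) (f : V → ℤ) : SimpleGraph V where
  Adj i j := G.Adj i j ∧ |f i - f j| = 1
  symm := ⟨fun i j h => ⟨h.1.symm, by rw [abs_sub_comm]; exact h.2⟩⟩
  loopless := ⟨fun i h => G.loopless.irrefl i h.1⟩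

/-- The integer labelings, normalized at `v`, that describe the facets of the symmetric edge
polytope of `G`. -/
def facetLabelings {V : Type*} (G : SimpleGraph V) (v : V) : Set (V → ℤ) :=
  {f | f v = 0 ∧ (∀ i j, G.Adj i j → |f i - f j| ≤ 1) ∧ (unitStepSubgraph G f).Connected}

/-! ### Invariance of the number of facet labelings -/

theorem SimpleGraph.Connected.eq_of_adj_eq {V α : Type*} {G : SimpleGraph V} (hG : G.Connected)
    (f : V → α) (h : ∀ i j, G.Adj i j → f i = f j) (i j : V) : f i = f j := by
  obtain ⟨p⟩ := hG.preconnected i j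
  induction p with
  | nil => rfl
  | cons hadj _ ih => exact (h _ _ hadj).trans ih

/-- Subtracting a constant preserves all differences, so it only moves the normalization. -/
theorem ncard_facetLabelings_basepoint {V : Type*} (G : SimpleGraph V) (v w : V) :
    (facetLabelings G v).ncard = (facetLabelings G w).ncard := by
  have key : ∀ (u : V) (f : V → ℤ) (c : ℤ), f u = c → (∀ i j, G.Adj i j → |f i - f j| ≤ 1) →
      (unitStepSubgraph G f).Connected → (fun x => f x - c) ∈ facetLabelings G u := by
    intro u f c h0 h1 h2
    refine ⟨by simp [h0], by simpa using h1, ?_⟩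
    convert h2 using 1
    ext i j
    simp [unitStepSubgraph]
  refine Set.ncard_congr (fun f _ x => f x - f w) ?_ ?_ ?_
  · intro f hf
    exact key w f _ rfl hf.2.1 hf.2.2
  · intro f g hf hg h
    have h' : ∀ x, f x - f w = g x - g w := fun x => congrFun h x
    have hv := h' v
    rw [hf.1, hg.1] at hv
    funext x
    have := h' x
    linarith
  · intro g hg
    refine ⟨fun x => g x - g v, key v g _ rfl hg.2.1 hg.2.2, ?_⟩
    funext x
    simp [hg.1]

theorem ncard_facetLabelings_iso {V W : Type*} {G : SimpleGraph V} {H : SimpleGraph W}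
    (e : G ≃g H) (v : V) (w : W) :
    (facetLabelings G v).ncard = (facetLabelings H w).ncard := by
  rw [ncard_facetLabelings_basepoint H w (e v)]
  have iso : ∀ g : W → ℤ, Nonempty (unitStepSubgraph G (g ∘ e) ≃g unitStepSubgraph H g) :=
    fun g => ⟨⟨e.toEquiv, by
      intro a b
      simp [unitStepSubgraph, e.map_adj_iff]⟩⟩
  symm
  refine Set.ncard_congr (fun g _ => g ∘ e) ?_ ?_ ?_
  · intro g hg
    refine ⟨hg.1, fun i j h => hg.2.1 _ _ (e.map_adj_iff.2 h), ?_⟩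
    exact (iso g).some.connected_iff.2 hg.2.2
  · intro f g _ _ h
    exact e.surjective.injective_comp_right h
  · intro f hf
    have hfe : (f ∘ e.symm) ∘ e = f := by
      funext x
      simp
    refine ⟨f ∘ e.symm, ⟨?_, ?_, ?_⟩, hfe⟩
    · simpa using hf.1
    · intro i j h
      exact hf.2.1 _ _ (e.symm.map_adj_iff.2 h)
    · refine (iso _).some.connected_iff.1 ?_
      rw [hfe]
      exact hf.2.2

/-! ### 1-sums and multiplicativity of the labeling count -/

/-- A 1-sum with explicit embeddings and retractions onto the two summands. -/
structure OneSumData {V V₁ V₂ : Type*} (G : SimpleGraph V) (G₁ : SimpleGraph V₁)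
    (G₂ : SimpleGraph V₂) where
  f₁ : V₁ ↪ V
  f₂ : V₂ ↪ V
  v₁ : V₁
  v₂ : V₂
  glue : f₁ v₁ = f₂ v₂
  r₁ : V → V₁
  r₂ : V → V₂
  r₁_f₁ : ∀ a, r₁ (f₁ a) = a
  r₂_f₂ : ∀ b, r₂ (f₂ b) = b
  r₁_f₂ : ∀ b, r₁ (f₂ b) = v₁
  r₂_f₁ : ∀ a, r₂ (f₁ a) = v₂
  cover : ∀ x, (∃ a, f₁ a = x) ∨ ∃ b, f₂ b = x
  adj_iff : ∀ x y : V, G.Adj x y ↔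
      (∃ a b : V₁, G₁.Adj a b ∧ f₁ a = x ∧ f₁ b = y) ∨
      (∃ a b : V₂, G₂.Adj a b ∧ f₂ a = x ∧ f₂ b = y)

theorem IsOneSum.exists_data {V V₁ V₂ : Type*} {G : SimpleGraph V} {G₁ : SimpleGraph V₁}
    {G₂ : SimpleGraph V₂} (h : IsOneSum G G₁ G₂) : Nonempty (OneSumData G G₁ G₂) := by
  classical
  obtain ⟨f₁, f₂, ⟨v, hv⟩, hu, hadj⟩ := h
  have hvm : v ∈ Set.range f₁ ∩ Set.range f₂ := hv ▸ rfl
  obtain ⟨⟨v₁, h1⟩, ⟨v₂, h2⟩⟩ := hvm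
  have huniq : ∀ a b, f₁ a = f₂ b → a = v₁ ∧ b = v₂ := by
    intro a b hab
    have hm : f₁ a ∈ Set.range f₁ ∩ Set.range f₂ := ⟨⟨a, rfl⟩, ⟨b, hab.symm⟩⟩
    rw [hv] at hm
    have hm' : f₁ a = v := hm
    exact ⟨f₁.injective (hm'.trans h1.symm), f₂.injective ((hab.symm.trans hm').trans h2.symm)⟩
  -- The default values make each retraction collapse the other summand to the glued vertex.
  refine ⟨⟨f₁, f₂, v₁, v₂, h1.trans h2.symm,
    fun x => if hx : ∃ a, f₁ a = x then hx.choose else v₁,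
    fun x => if hx : ∃ a, f₂ a = x then hx.choose else v₂, ?_, ?_, ?_, ?_, ?_, hadj⟩⟩
  · intro a
    have hx : ∃ a', f₁ a' = f₁ a := ⟨a, rfl⟩
    rw [dif_pos hx]
    exact f₁.injective hx.choose_spec
  · intro a
    have hx : ∃ a', f₂ a' = f₂ a := ⟨a, rfl⟩
    rw [dif_pos hx]
    exact f₂.injective hx.choose_spec
  · intro b
    split_ifs with hx
    · exact (huniq _ _ hx.choose_spec).1
    · rfl
  · intro b
    split_ifs with hx
    · exact (huniq _ _ hx.choose_spec.symm).2
    · rfl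
  · intro x
    have : x ∈ Set.range f₁ ∪ Set.range f₂ := hu ▸ trivial
    exact this

namespace OneSumData

variable {V V₁ V₂ : Type*} {G : SimpleGraph V} {G₁ : SimpleGraph V₁} {G₂ : SimpleGraph V₂}

/-- Exchange the two summands. -/
def swap (D : OneSumData G G₁ G₂) : OneSumData G G₂ G₁ where
  f₁ := D.f₂
  f₂ := D.f₁
  v₁ := D.v₂
  v₂ := D.v₁
  glue := D.glue.symm
  r₁ := D.r₂
  r₂ := D.r₁
  r₁_f₁ := D.r₂_f₂
  r₂_f₂ := D.r₁_f₁
  r₁_f₂ := D.r₂_f₁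
  r₂_f₁ := D.r₁_f₂
  cover x := (D.cover x).symm
  adj_iff x y := (D.adj_iff x y).trans or_comm

theorem eq_of_f₁_eq_f₂ (D : OneSumData G G₁ G₂) {a : V₁} {b : V₂} (h : D.f₁ a = D.f₂ b) :
    a = D.v₁ ∧ b = D.v₂ :=
  ⟨by rw [← D.r₁_f₁ a, h, D.r₁_f₂], by rw [← D.r₂_f₂ b, ← h, D.r₂_f₁]⟩

theorem adj_f₁ (D : OneSumData G G₁ G₂) {a b : V₁} :
    G.Adj (D.f₁ a) (D.f₁ b) ↔ G₁.Adj a b := by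
  rw [D.adj_iff]
  constructor
  · rintro (⟨a', b', h, ha, hb⟩ | ⟨a', b', h, ha, hb⟩)
    · rwa [← D.f₁.injective ha, ← D.f₁.injective hb]
    · exact absurd ((D.eq_of_f₁_eq_f₂ ha.symm).2.trans (D.eq_of_f₁_eq_f₂ hb.symm).2.symm) h.ne
  · exact fun h => Or.inl ⟨a, b, h, rfl, rfl⟩

theorem adj_f₂ (D : OneSumData G G₁ G₂) {a b : V₂} :
    G.Adj (D.f₂ a) (D.f₂ b) ↔ G₂.Adj a b := D.swap.adj_f₁

theorem not_adj_f₁_f₂ (D : OneSumData G G₁ G₂) {a : V₁} {b : V₂} (ha : a ≠ D.v₁) (hb : b ≠ D.v₂) :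
    ¬ G.Adj (D.f₁ a) (D.f₂ b) := by
  rw [D.adj_iff]
  rintro (⟨a', b', h, h1, h2⟩ | ⟨a', b', h, h1, h2⟩)
  · exact hb (D.eq_of_f₁_eq_f₂ h2).2
  · exact ha (D.eq_of_f₁_eq_f₂ h1.symm).1

theorem isOneSum (D : OneSumData G G₁ G₂) : IsOneSum G G₁ G₂ := by
  refine ⟨D.f₁, D.f₂, ⟨D.f₁ D.v₁, ?_⟩, ?_, D.adj_iff⟩
  · ext x
    constructor
    · rintro ⟨⟨a, rfl⟩, ⟨b, hb⟩⟩
      rw [(D.eq_of_f₁_eq_f₂ hb.symm).1]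
      rfl
    · rintro rfl
      exact ⟨⟨_, rfl⟩, ⟨_, D.glue.symm⟩⟩
  · exact Set.eq_univ_of_forall D.cover

/-- The retraction `r₁` sends an edge of `G` to an edge of `G₁` or to a single vertex, so it carries
walks to walks. -/
theorem left_connected (D : OneSumData G G₁ G₂) (h : G.Connected) : G₁.Connected := by
  have : Nonempty V₁ := ⟨D.v₁⟩
  refine ⟨fun a b => ?_⟩
  obtain ⟨p⟩ := h.preconnected (D.f₁ a) (D.f₁ b)
  have key : ∀ x y : V, G.Walk x y → G₁.Reachable (D.r₁ x) (D.r₁ y) := by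
    intro x y p
    induction p with
    | nil => exact SimpleGraph.Reachable.refl _
    | cons hadj _ ih =>
      refine SimpleGraph.Reachable.trans ?_ ih
      rcases (D.adj_iff _ _).1 hadj with ⟨a, b, h, rfl, rfl⟩ | ⟨a, b, h, rfl, rfl⟩
      · rw [D.r₁_f₁, D.r₁_f₁]
        exact h.reachable
      · rw [D.r₁_f₂, D.r₁_f₂]
  simpa [D.r₁_f₁] using key _ _ p

theorem connected_iff (D : OneSumData G G₁ G₂) :
    G.Connected ↔ G₁.Connected ∧ G₂.Connected := by
  refine ⟨fun h => ⟨D.left_connected h, D.swap.left_connected h⟩, fun ⟨h1, h2⟩ => ?_⟩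
  have hom1 : ∀ a, G.Reachable (D.f₁ a) (D.f₁ D.v₁) := fun a =>
    (h1.preconnected a D.v₁).map ⟨D.f₁, fun h => D.adj_f₁.2 h⟩
  have hom2 : ∀ a, G.Reachable (D.f₂ a) (D.f₁ D.v₁) := fun a => by
    rw [D.glue]
    exact (h2.preconnected a D.v₂).map ⟨D.f₂, fun h => D.adj_f₂.2 h⟩
  have hall : ∀ x, G.Reachable x (D.f₁ D.v₁) := by
    intro x
    rcases D.cover x with ⟨a, rfl⟩ | ⟨a, rfl⟩
    exacts [hom1 a, hom2 a]
  have : Nonempty V := ⟨D.f₁ D.v₁⟩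
  exact ⟨fun x y => (hall x).trans (hall y).symm⟩

/-- The unit step subgraph of a 1-sum is the 1-sum of the unit step subgraphs. -/
def unitStep (D : OneSumData G G₁ G₂) (f : V → ℤ) :
    OneSumData (unitStepSubgraph G f) (unitStepSubgraph G₁ (f ∘ D.f₁))
      (unitStepSubgraph G₂ (f ∘ D.f₂)) where
  __ := D
  adj_iff x y := by
    constructor
    · rintro ⟨h, hf⟩
      rcases (D.adj_iff _ _).1 h with ⟨a, b, h', rfl, rfl⟩ | ⟨a, b, h', rfl, rfl⟩
      · exact Or.inl ⟨a, b, ⟨h', hf⟩, rfl, rfl⟩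
      · exact Or.inr ⟨a, b, ⟨h', hf⟩, rfl, rfl⟩
    · rintro (⟨a, b, ⟨h, hf⟩, rfl, rfl⟩ | ⟨a, b, ⟨h, hf⟩, rfl, rfl⟩)
      · exact ⟨D.adj_f₁.2 h, hf⟩
      · exact ⟨D.adj_f₂.2 h, hf⟩

theorem mem_facetLabelings_iff (D : OneSumData G G₁ G₂) (f : V → ℤ) :
    f ∈ facetLabelings G (D.f₁ D.v₁) ↔
      f ∘ D.f₁ ∈ facetLabelings G₁ D.v₁ ∧ f ∘ D.f₂ ∈ facetLabelings G₂ D.v₂ := by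
  constructor
  · rintro ⟨h0, h1, h2⟩
    have hc := (D.unitStep f).connected_iff.1 h2
    exact ⟨⟨h0, fun i j h => h1 _ _ (D.adj_f₁.2 h), hc.1⟩,
      ⟨by rw [D.glue] at h0; exact h0, fun i j h => h1 _ _ (D.adj_f₂.2 h), hc.2⟩⟩
  · rintro ⟨⟨h0, h1, h2⟩, ⟨-, k1, k2⟩⟩
    refine ⟨h0, fun i j h => ?_, (D.unitStep f).connected_iff.2 ⟨h2, k2⟩⟩
    rcases (D.adj_iff _ _).1 h with ⟨a, b, h', rfl, rfl⟩ | ⟨a, b, h', rfl, rfl⟩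
    · exact h1 _ _ h'
    · exact k1 _ _ h'

/-- Restriction to the two summands is a bijection. With all labelings normalized to 0 at the glued
vertex, any pair extends uniquely. -/
theorem ncard_facetLabelings (D : OneSumData G G₁ G₂) (v : V) (v₁ : V₁) (v₂ : V₂) :
    (facetLabelings G v).ncard =
      (facetLabelings G₁ v₁).ncard * (facetLabelings G₂ v₂).ncard := by
  rw [ncard_facetLabelings_basepoint G v (D.f₁ D.v₁),
    ncard_facetLabelings_basepoint G₁ v₁ D.v₁, ncard_facetLabelings_basepoint G₂ v₂ D.v₂,
    ← Set.ncard_prod]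
  refine Set.ncard_congr (fun f _ => (f ∘ D.f₁, f ∘ D.f₂)) ?_ ?_ ?_
  · exact fun f hf => (D.mem_facetLabelings_iff f).1 hf
  · intro f g _ _ h
    have h1 := congrArg Prod.fst h
    have h2 := congrArg Prod.snd h
    funext x
    rcases D.cover x with ⟨a, rfl⟩ | ⟨a, rfl⟩
    exacts [congrFun h1 a, congrFun h2 a]
  · rintro ⟨g₁, g₂⟩ ⟨hg1, hg2⟩
    have z1 : g₁ D.v₁ = 0 := hg1.1
    have z2 : g₂ D.v₂ = 0 := hg2.1
    -- The sum of the two pullbacks glues the pair: on each copy the other term is constantly 0.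
    have e1 : (fun x => g₁ (D.r₁ x) + g₂ (D.r₂ x)) ∘ D.f₁ = g₁ := by
      funext a
      simp [D.r₁_f₁, D.r₂_f₁, z2]
    have e2 : (fun x => g₁ (D.r₁ x) + g₂ (D.r₂ x)) ∘ D.f₂ = g₂ := by
      funext a
      simp [D.r₂_f₂, D.r₁_f₂, z1]
    exact ⟨fun x => g₁ (D.r₁ x) + g₂ (D.r₂ x),
      (D.mem_facetLabelings_iff _).2 ⟨e1.symm ▸ hg1, e2.symm ▸ hg2⟩, by rw [e1, e2]⟩

theorem card_add_one [Finite V] (D : OneSumData G G₁ G₂) :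
    Nat.card V + 1 = Nat.card V₁ + Nat.card V₂ := by
  obtain ⟨f₁, f₂, ⟨v, hv⟩, hu, -⟩ := D.isOneSum
  have h := Set.ncard_union_add_ncard_inter (Set.range f₁) (Set.range f₂)
  rw [hu, hv, Set.ncard_univ, Set.ncard_singleton, ← Set.image_univ, ← Set.image_univ,
    Set.ncard_image_of_injective _ f₁.injective, Set.ncard_image_of_injective _ f₂.injective,
    Set.ncard_univ, Set.ncard_univ] at h
  exact h

/-- A 1-sum with a one-vertex graph is a copy of the other summand. -/
theorem nonempty_iso_of_subsingleton (D : OneSumData G G₁ G₂) [Subsingleton V₁] :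
    Nonempty (G₂ ≃g G) := by
  have hs : Function.Surjective D.f₂ := by
    intro x
    rcases D.cover x with ⟨a, rfl⟩ | h
    · exact ⟨D.v₂, by rw [← D.glue, Subsingleton.elim a D.v₁]⟩
    · exact h
  exact ⟨⟨Equiv.ofBijective D.f₂ ⟨D.f₂.injective, hs⟩, D.adj_f₂⟩⟩

end OneSumData

/-! ### Facet labelings of complete graphs -/

/-- All values lie within one of each other, and connectivity forces two values to occur. Up to a
constant the labelings are thus the indicators of the nonempty proper subsets. -/
theorem ncard_facetLabelings_top {V : Type*} [Finite V] (hV : 2 ≤ Nat.card V) (v : V) :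
    (facetLabelings (⊤ : SimpleGraph V) v).ncard = 2 ^ Nat.card V - 2 := by
  classical
  have := Fintype.ofFinite V
  have : Nontrivial V := Finite.one_lt_card_iff_nontrivial.1 hV
  have hcard : ((Finset.univ : Finset (Finset V)) \ {∅, Finset.univ}).card = 2 ^ Nat.card V - 2 := by
    rw [Finset.card_sdiff_of_subset (Finset.subset_univ _), Finset.card_univ, Fintype.card_finset,
      Nat.card_eq_fintype_card, Finset.card_pair Finset.univ_nonempty.ne_empty.symm]
  rw [← hcard, ← Set.ncard_coe_finset]
  symm
  refine Set.ncard_congr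
    (fun S _ x => (if x ∈ S then (1 : ℤ) else 0) - if v ∈ S then 1 else 0) ?_ ?_ ?_
  · intro S hS
    have hS' : S ≠ ∅ ∧ S ≠ Finset.univ := by simpa using hS
    obtain ⟨a, ha⟩ := Finset.nonempty_iff_ne_empty.2 hS'.1
    obtain ⟨b, hb⟩ : ∃ b, b ∉ S := by
      by_contra! h
      exact hS'.2 (Finset.eq_univ_iff_forall.2 h)
    refine ⟨by simp, fun i j _ => by dsimp only; split_ifs <;> simp, ?_⟩
    -- The unit steps join every vertex of `S` to every vertex outside, and neither side is empty.
    have hadj : ∀ i ∈ S, ∀ j ∉ S, (unitStepSubgraph (⊤ : SimpleGraph V) fun x =>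
        (if x ∈ S then (1 : ℤ) else 0) - if v ∈ S then 1 else 0).Reachable i j := by
      intro i hi j hj
      refine SimpleGraph.Adj.reachable ⟨?_, ?_⟩
      · rintro rfl
        exact hj hi
      · simp [hi, hj]
    have hb' : ∀ i, (unitStepSubgraph (⊤ : SimpleGraph V) fun x =>
        (if x ∈ S then (1 : ℤ) else 0) - if v ∈ S then 1 else 0).Reachable i a := by
      intro i
      by_cases hi : i ∈ S
      · exact (hadj i hi b hb).trans (hadj a ha b hb).symm
      · exact (hadj a ha i hi).symm
    exact ⟨fun i j => (hb' i).trans (hb' j).symm⟩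
  · intro S T hS hT h
    have h' : ∀ x, ((if x ∈ S then (1 : ℤ) else 0) - if v ∈ S then 1 else 0) =
      (if x ∈ T then (1 : ℤ) else 0) - if v ∈ T then 1 else 0 := fun x => congrFun h x
    have hS' : S ≠ ∅ ∧ S ≠ Finset.univ := by simpa using hS
    have hT' : T ≠ ∅ ∧ T ≠ Finset.univ := by simpa using hT
    by_cases hvS : v ∈ S <;> by_cases hvT : v ∈ T <;> simp only [hvS, hvT, if_true, if_false] at h'
    · ext x
      have := h' x
      by_cases hx : x ∈ S <;> by_cases hy : x ∈ T <;> simp_all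
    -- Here the indicator of `S` is that of `T` plus 1, which forces `S` to be everything.
    · exfalso
      apply hS'.2
      ext x
      have := h' x
      by_cases hx : x ∈ S <;> by_cases hy : x ∈ T <;> simp_all
    · exfalso
      apply hT'.2
      ext x
      have := h' x
      by_cases hx : x ∈ S <;> by_cases hy : x ∈ T <;> simp_all
    · ext x
      have := h' x
      by_cases hx : x ∈ S <;> by_cases hy : x ∈ T <;> simp_all
  · intro f hf
    obtain ⟨h0, h1, h2⟩ := hf
    have hle : ∀ i j, f i ≤ f j + 1 := by
      intro i j
      by_cases hij : i = j
      · subst hij; omega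
      · have := abs_le.1 (h1 i j hij)
        omega
    obtain ⟨m, hm⟩ := Finite.exists_min f
    obtain ⟨w, hw⟩ := h2.preconnected.exists_adj_of_nontrivial m
    have hmw : f w = f m + 1 := by
      have h3 := hw.2
      have h4 := hm w
      have h5 := hle w m
      rcases abs_eq (by norm_num : (0 : ℤ) ≤ 1) |>.1 h3 with h | h <;> omega
    have hval : ∀ x, (if f m < f x then (1 : ℤ) else 0) = f x - f m := by
      intro x
      have h4 := hm x
      have h5 := hle x m
      split_ifs <;> omega
    refine ⟨Finset.univ.filter fun x => f m < f x, ?_, ?_⟩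
    · have hw' : w ∈ Finset.univ.filter fun x => f m < f x := by simp [hmw]
      have hm' : m ∉ Finset.univ.filter fun x => f m < f x := by simp
      simp only [Finset.coe_sdiff, Set.mem_sdiff, Finset.coe_univ, Set.mem_univ, true_and,
        Finset.mem_coe, Finset.mem_insert, Finset.mem_singleton, not_or]
      refine ⟨fun h => ?_, fun h => ?_⟩
      · rw [h] at hw'
        simp at hw'
      · rw [h] at hm'
        simp at hm'
    · funext x
      simp only [Finset.mem_filter, Finset.mem_univ, true_and, hval]
      rw [h0]
      ring

/-! ### Facets of the symmetric edge polytope as labelings -/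

open Classical in
/-- The generators of the symmetric edge polytope. -/
noncomputable def edgeVectors {V : Type*} (G : SimpleGraph V) : Set (V → ℝ) :=
  {x | ∃ i j : V, G.Adj i j ∧ x = Pi.single i 1 - Pi.single j 1}

theorem symmetricEdgePolytope_eq {V : Type*} (G : SimpleGraph V) :
    symmetricEdgePolytope G = convexHull ℝ (edgeVectors G) := rfl

open Classical in
theorem SimpleGraph.Connected.single_sub_single_mem_span {V : Type*} {G : SimpleGraph V}
    (hG : G.Connected) {S : Submodule ℝ (V → ℝ)}
    (hS : ∀ i j, G.Adj i j → (Pi.single i 1 - Pi.single j 1 : V → ℝ) ∈ S) (i j : V) :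
    (Pi.single i 1 - Pi.single j 1 : V → ℝ) ∈ S := by
  obtain ⟨p⟩ := hG.preconnected i j
  induction p with
  | nil => simp
  | cons h _ ih =>
    have := S.add_mem (hS _ _ h) ih
    rwa [sub_add_sub_cancel] at this

/-- `F` lies in an affine hyperplane missing the origin, so its linear span is its direction space
plus one independent line. -/
theorem finrank_vectorSpan_add_one {E : Type*} [AddCommGroup E] [Module ℝ E]
    [FiniteDimensional ℝ E] {F : Set E} (hF : F.Nonempty) (l : E →ₗ[ℝ] ℝ)
    (hl : ∀ x ∈ F, l x = 1) :
    Module.finrank ℝ (vectorSpan ℝ F) + 1 = Module.finrank ℝ (Submodule.span ℝ F) := by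
  obtain ⟨x₀, hx₀⟩ := hF
  have hx0 : x₀ ≠ 0 := by
    rintro rfl
    simpa using hl 0 hx₀
  have hker : vectorSpan ℝ F ≤ LinearMap.ker l := by
    rw [vectorSpan_def, Submodule.span_le]
    rintro _ ⟨a, ha, b, hb, rfl⟩
    simp [hl a ha, hl b hb]
  have hsup : Submodule.span ℝ F = vectorSpan ℝ F ⊔ Submodule.span ℝ {x₀} := by
    apply le_antisymm
    · rw [Submodule.span_le]
      intro x hx
      have h1 : x - x₀ ∈ vectorSpan ℝ F := vsub_mem_vectorSpan ℝ hx hx₀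
      have h2 := Submodule.add_mem_sup h1 (Submodule.mem_span_singleton_self (R := ℝ) x₀)
      simpa using h2
    · refine sup_le ?_ ?_
      · rw [vectorSpan_def, Submodule.span_le]
        rintro _ ⟨a, ha, b, hb, rfl⟩
        exact Submodule.sub_mem _ (Submodule.subset_span ha) (Submodule.subset_span hb)
      · rw [Submodule.span_singleton_le_iff_mem]
        exact Submodule.subset_span hx₀
  have hinf : vectorSpan ℝ F ⊓ Submodule.span ℝ {x₀} = ⊥ := by
    rw [eq_bot_iff]
    rintro y ⟨h1, h2⟩
    obtain ⟨c, rfl⟩ := Submodule.mem_span_singleton.1 h2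
    have h3 := hker h1
    rw [LinearMap.mem_ker, map_smul, hl x₀ hx₀, smul_eq_mul, mul_one] at h3
    simp [h3]
  have h := Submodule.finrank_sup_add_finrank_inf_eq (vectorSpan ℝ F) (Submodule.span ℝ {x₀})
  rw [hinf, finrank_bot, ← hsup, finrank_span_singleton hx0] at h
  omega

theorem vectorSpan_eq_span_of_zero_mem {E : Type*} [AddCommGroup E] [Module ℝ E] {P : Set E}
    (h : (0 : E) ∈ P) : vectorSpan ℝ P = Submodule.span ℝ P := by
  rw [vectorSpan_eq_span_vsub_set_right ℝ h]
  simp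

/-- A point of a convex hull at which a linear functional attains its upper bound on the generators
is a combination of the generators at which the bound is attained. -/
theorem mem_span_of_mem_convexHull {E : Type*} [AddCommGroup E] [Module ℝ E] {A : Set E}
    (l : E →ₗ[ℝ] ℝ) {M : ℝ} (hl : ∀ a ∈ A, l a ≤ M) {x : E} (hx : x ∈ convexHull ℝ A)
    (hlx : l x = M) : x ∈ Submodule.span ℝ {a ∈ A | l a = M} := by
  rw [convexHull_eq] at hx
  obtain ⟨ι, t, w, z, hw, hw1, hz, rfl⟩ := hx
  rw [Finset.centerMass_eq_of_sum_1 _ _ hw1] at hlx ⊢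
  -- A vanishing sum of nonnegative terms: every generator with positive weight attains the bound.
  have h0 : ∑ i ∈ t, w i * (M - l (z i)) = 0 := by
    simp only [mul_sub, Finset.sum_sub_distrib, ← Finset.sum_mul, hw1]
    rw [map_sum] at hlx
    simp only [map_smul, smul_eq_mul] at hlx
    rw [hlx]
    ring
  rw [Finset.sum_eq_zero_iff_of_nonneg
    (fun i hi => mul_nonneg (hw i hi) (sub_nonneg.2 (hl _ (hz i hi))))] at h0
  refine Submodule.sum_mem _ fun i hi => ?_
  rcases mul_eq_zero.1 (h0 i hi) with h | h
  · simp [h]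
  · exact Submodule.smul_mem _ _ (Submodule.subset_span ⟨hz i hi, by linarith⟩)

theorem le_of_mem_convexHull {E : Type*} [AddCommGroup E] [Module ℝ E] {A : Set E}
    (l : E →ₗ[ℝ] ℝ) {M : ℝ} (hl : ∀ a ∈ A, l a ≤ M) {x : E} (hx : x ∈ convexHull ℝ A) :
    l x ≤ M :=
  convexHull_min hl (convex_halfSpace_le l.isLinear M) hx

theorem zero_mem_symmetricEdgePolytope {V : Type*} {G : SimpleGraph V} {i j : V} (h : G.Adj i j) :
    (0 : V → ℝ) ∈ symmetricEdgePolytope G := by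
  classical
  rw [symmetricEdgePolytope_eq]
  have h1 := subset_convexHull ℝ (edgeVectors G) ⟨i, j, h, rfl⟩
  have h2 := subset_convexHull ℝ (edgeVectors G) ⟨j, i, h.symm, rfl⟩
  have := convex_convexHull ℝ (edgeVectors G) h1 h2 (by norm_num : (0 : ℝ) ≤ 1 / 2)
    (by norm_num : (0 : ℝ) ≤ 1 / 2) (by norm_num)
  rw [← smul_add, sub_add_sub_cancel, sub_self, smul_zero] at this
  exact this

theorem span_symmetricEdgePolytope {V : Type*} {G : SimpleGraph V} :
    Submodule.span ℝ (symmetricEdgePolytope G) = Submodule.span ℝ (edgeVectors G) :=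
  le_antisymm
    (Submodule.span_le.2 (convexHull_min Submodule.subset_span (Submodule.convex _)))
    (Submodule.span_mono (subset_convexHull ℝ _))

theorem neg_mem_edgeVectors {V : Type*} {G : SimpleGraph V} {x : V → ℝ} (h : x ∈ edgeVectors G) :
    -x ∈ edgeVectors G := by
  obtain ⟨i, j, h, rfl⟩ := h
  exact ⟨j, i, h.symm, neg_sub _ _⟩

/-- Every facet of the symmetric edge polytope is cut out by a functional with value one. -/
theorem IsFacet.exists_functional {V : Type*} {G : SimpleGraph V} (hG : G.Connected)
    [Nontrivial V] {F : Set (V → ℝ)}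
    (hF : IsFacet (symmetricEdgePolytope G) F) :
    ∃ l : (V → ℝ) →ₗ[ℝ] ℝ, (∀ a ∈ edgeVectors G, l a ≤ 1) ∧
      F = {x ∈ symmetricEdgePolytope G | l x = 1} := by
  obtain ⟨hexp, hne, hdim⟩ := hF
  obtain ⟨l, hl⟩ := hexp hne
  obtain ⟨x₀, hx₀⟩ := id hne
  obtain ⟨v⟩ := hG.nonempty
  obtain ⟨w, hw⟩ := hG.preconnected.exists_adj_of_nontrivial v
  have h0 := zero_mem_symmetricEdgePolytope hw
  have hx₀' := hx₀
  rw [hl] at hx₀'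
  have hMnn : 0 ≤ l x₀ := by simpa using hx₀'.2 0 h0
  have hsub : edgeVectors G ⊆ symmetricEdgePolytope G := subset_convexHull ℝ _
  -- By central symmetry, maximum 0 would make `l` vanish on the whole polytope, so that `F` would
  -- not be a proper face. A positive maximum can be rescaled to 1.
  have hMpos : 0 < l x₀ := by
    rcases hMnn.lt_or_eq with h | h
    · exact h
    exfalso
    have hzero : ∀ a ∈ edgeVectors G, l a = 0 := by
      intro a ha
      have h1 := hx₀'.2 a (hsub ha)
      have h2 := hx₀'.2 _ (hsub (neg_mem_edgeVectors ha))
      rw [map_neg] at h2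
      linarith
    have hzero' : ∀ y ∈ symmetricEdgePolytope G, l y ≤ 0 := fun y hy =>
      le_of_mem_convexHull l.toLinearMap (fun a ha => (hzero a ha).le) hy
    have hzero'' : ∀ y ∈ symmetricEdgePolytope G, 0 ≤ l y := fun y hy => by
      have := le_of_mem_convexHull (M := 0) (-l.toLinearMap)
        (fun a ha => by simp [hzero a ha]) hy
      simpa using this
    have hFP : F = symmetricEdgePolytope G := by
      rw [hl]
      exact Set.sep_eq_self_iff_mem_true.2 fun x hx y hy => (hzero' y hy).trans (hzero'' x hx)
    rw [hFP] at hdim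
    omega
  refine ⟨(l x₀)⁻¹ • l.toLinearMap, ?_, ?_⟩
  · intro a ha
    have := hx₀'.2 a (hsub ha)
    simp only [LinearMap.smul_apply, smul_eq_mul]
    rw [inv_mul_le_iff₀ hMpos, mul_one]
    exact this
  · rw [hl]
    ext x
    simp only [Set.mem_ofPred_eq, LinearMap.smul_apply, smul_eq_mul]
    refine and_congr_right fun hx => ?_
    rw [inv_mul_eq_one₀ hMpos.ne']
    exact ⟨fun h => le_antisymm (h x₀ hx₀'.1) (hx₀'.2 x hx), fun h y hy => h ▸ hx₀'.2 y hy⟩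

section

variable {V : Type*} [Fintype V] {G : SimpleGraph V}

/-- The linear functional with coefficients given by a labeling. -/
noncomputable def labelingFunctional (f : V → ℤ) : StrongDual ℝ (V → ℝ) :=
  ∑ i, (f i : ℝ) • ContinuousLinearMap.proj i

open Classical in
theorem labelingFunctional_single_sub (f : V → ℤ) (i j : V) :
    labelingFunctional f (Pi.single i 1 - Pi.single j 1) = f i - f j := by
  simp [labelingFunctional, Pi.single_apply, mul_sub, Finset.sum_sub_distrib]

/-- The face of the symmetric edge polytope cut out by a labeling. -/
noncomputable def labelingFace (G : SimpleGraph V) (f : V → ℤ) : Set (V → ℝ) :=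
  {x ∈ symmetricEdgePolytope G | labelingFunctional f x = 1}

theorem labelingFunctional_le_one {f : V → ℤ} (hf : ∀ i j, G.Adj i j → |f i - f j| ≤ 1)
    {x : V → ℝ} (hx : x ∈ symmetricEdgePolytope G) : labelingFunctional f x ≤ 1 := by
  refine le_of_mem_convexHull (labelingFunctional f).toLinearMap ?_ hx
  rintro _ ⟨i, j, h, rfl⟩
  have := (labelingFunctional_single_sub f i j).le
  have h2 := (abs_le.1 (hf i j h)).2
  refine this.trans ?_
  exact_mod_cast h2

open Classical in
theorem single_sub_single_mem_labelingFace {f : V → ℤ} {i j : V} (h : G.Adj i j)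
    (hf : f i - f j = 1) : (Pi.single i 1 - Pi.single j 1 : V → ℝ) ∈ labelingFace G f := by
  refine ⟨subset_convexHull ℝ _ ⟨i, j, h, rfl⟩, ?_⟩
  rw [labelingFunctional_single_sub]
  exact_mod_cast hf

theorem labelingFace_nonempty [Nontrivial V] {f : V → ℤ}
    (hc : (unitStepSubgraph G f).Connected) : (labelingFace G f).Nonempty := by
  classical
  obtain ⟨v⟩ := hc.nonempty
  obtain ⟨w, hw⟩ := hc.preconnected.exists_adj_of_nontrivial v
  rcases (abs_eq zero_le_one).1 hw.2 with h | h
  · exact ⟨_, single_sub_single_mem_labelingFace hw.1 h⟩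
  · exact ⟨_, single_sub_single_mem_labelingFace hw.1.symm (by omega)⟩

/-- Unit steps, suitably oriented, lie in the face. Being connected, they span all differences of
basis vectors, so the face has the same linear span as the polytope and codimension one. -/
theorem isFacet_labelingFace [Nontrivial V] {v : V} {f : V → ℤ} (hf : f ∈ facetLabelings G v) :
    IsFacet (symmetricEdgePolytope G) (labelingFace G f) := by
  classical
  obtain ⟨-, hle, hc⟩ := hf
  have hne := labelingFace_nonempty hc
  obtain ⟨x₀, hx₀, hl₀⟩ := id hne
  refine ⟨fun _ => ⟨labelingFunctional f, ?_⟩, hne, ?_⟩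
  · ext x
    constructor
    · rintro ⟨hx, hl⟩
      exact ⟨hx, fun y hy => hl ▸ labelingFunctional_le_one hle hy⟩
    · rintro ⟨hx, hl⟩
      exact ⟨hx, le_antisymm (labelingFunctional_le_one hle hx) (hl₀ ▸ hl x₀ hx₀)⟩
  · obtain ⟨w, hw⟩ := hc.preconnected.exists_adj_of_nontrivial v
    rw [finrank_vectorSpan_add_one hne (labelingFunctional f).toLinearMap (fun x hx => hx.2),
      vectorSpan_eq_span_of_zero_mem (zero_mem_symmetricEdgePolytope hw.1)]
    suffices h : Submodule.span ℝ (labelingFace G f) =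
        Submodule.span ℝ (symmetricEdgePolytope G) by rw [h]
    refine le_antisymm (Submodule.span_mono fun x hx => hx.1) ?_
    rw [span_symmetricEdgePolytope, Submodule.span_le]
    rintro _ ⟨i, j, -, rfl⟩
    refine hc.single_sub_single_mem_span (fun a b hab => ?_) i j
    rcases (abs_eq zero_le_one).1 hab.2 with h | h
    · exact Submodule.subset_span (single_sub_single_mem_labelingFace hab.1 h)
    · rw [← neg_sub]
      exact Submodule.neg_mem _ (Submodule.subset_span
        (single_sub_single_mem_labelingFace hab.1.symm (by omega)))

/-- The face records the oriented unit steps of `f`. Along these `f - g` is constant, and they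
connect all vertices. -/
theorem labelingFace_injOn (v : V) : Set.InjOn (labelingFace G) (facetLabelings G v) := by
  classical
  intro f hf g hg hfg
  have key : ∀ i j, G.Adj i j → f i - f j = 1 → g i - g j = 1 := by
    intro i j h h1
    have hm := single_sub_single_mem_labelingFace h h1
    rw [hfg] at hm
    have := hm.2
    rw [labelingFunctional_single_sub] at this
    exact_mod_cast this
  funext x
  have := hf.2.2.eq_of_adj_eq (fun x => f x - g x) (by
    rintro i j ⟨h, h1⟩
    rcases (abs_eq zero_le_one).1 h1 with h2 | h2
    · have := key i j h h2
      omega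
    · have := key j i h.symm (by omega)
      omega) x v
  simp only [hf.1, hg.1] at this
  omega

/-- The edge vectors on the facet span those of all edges, which makes the unit steps of the real
labeling `g` connected. As `g` is 0 at `v`, it is then integral. -/
theorem IsFacet.exists_labeling (hG : G.Connected) [Nontrivial V] (v : V) {F : Set (V → ℝ)}
    (hF : IsFacet (symmetricEdgePolytope G) F) :
    ∃ f ∈ facetLabelings G v, labelingFace G f = F := by
  classical
  obtain ⟨l, hl, hFl⟩ := hF.exists_functional hG
  obtain ⟨w, hw⟩ := hG.preconnected.exists_adj_of_nontrivial v
  have hspan : Submodule.span ℝ F = Submodule.span ℝ (edgeVectors G) := by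
    have hd := hF.2.2
    rw [finrank_vectorSpan_add_one hF.2.1 l (fun x hx => by rw [hFl] at hx; exact hx.2),
      vectorSpan_eq_span_of_zero_mem (zero_mem_symmetricEdgePolytope hw)] at hd
    rw [← span_symmetricEdgePolytope]
    exact Submodule.eq_of_le_of_finrank_eq
      (Submodule.span_mono fun x hx => by rw [hFl] at hx; exact hx.1) hd
  have hspan' : Submodule.span ℝ (edgeVectors G) ≤
      Submodule.span ℝ {a ∈ edgeVectors G | l a = 1} := by
    rw [← hspan, Submodule.span_le]
    intro x hx
    rw [hFl] at hx
    exact mem_span_of_mem_convexHull l hl hx.1 hx.2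
  let g : V → ℝ := fun i => l (Pi.single i 1) - l (Pi.single v 1)
  have hg : ∀ i j, l (Pi.single i 1 - Pi.single j 1) = g i - g j := by
    intro i j
    simp [g]
  have hgle : ∀ i j, G.Adj i j → g i - g j ≤ 1 := fun i j h => hg i j ▸ hl _ ⟨i, j, h, rfl⟩
  let H : SimpleGraph V :=
    { Adj := fun i j => G.Adj i j ∧ |g i - g j| = 1
      symm := ⟨fun i j h => ⟨h.1.symm, by rw [abs_sub_comm]; exact h.2⟩⟩
      loopless := ⟨fun i h => G.loopless.irrefl i h.1⟩ }
  have hH : H.Connected := by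
    have : Nonempty V := ⟨v⟩
    refine ⟨fun i j => ?_⟩
    by_contra hij
    -- the indicator functional of the component of `i` vanishes on all unit steps
    let φ : (V → ℝ) →ₗ[ℝ] ℝ :=
      ∑ k, (if H.Reachable i k then (1 : ℝ) else 0) • LinearMap.proj k
    have hφ : ∀ a b, φ (Pi.single a 1 - Pi.single b 1) =
        (if H.Reachable i a then (1 : ℝ) else 0) - if H.Reachable i b then 1 else 0 := by
      intro a b
      simp only [φ, LinearMap.sum_apply, LinearMap.smul_apply, LinearMap.proj_apply,
        Pi.sub_apply, smul_eq_mul, mul_sub, Finset.sum_sub_distrib]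
      simp [Pi.single_apply]
    have hker : Submodule.span ℝ {a ∈ edgeVectors G | l a = 1} ≤ LinearMap.ker φ := by
      rw [Submodule.span_le]
      rintro _ ⟨⟨a, b, hab, rfl⟩, h1⟩
      have hadj : H.Adj a b := ⟨hab, by rw [← hg, h1, abs_one]⟩
      have : H.Reachable i a ↔ H.Reachable i b :=
        ⟨fun h => h.trans hadj.reachable, fun h => h.trans hadj.symm.reachable⟩
      simp [hφ, this]
    have hmem := hker (hspan' (hG.single_sub_single_mem_span
      (S := Submodule.span ℝ (edgeVectors G))
      (fun a b hab => Submodule.subset_span ⟨a, b, hab, rfl⟩) i j))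
    rw [LinearMap.mem_ker, hφ, if_pos (SimpleGraph.Reachable.refl i), if_neg hij] at hmem
    norm_num at hmem
  have hint : ∀ x, ∃ n : ℤ, g x = n := by
    intro x
    -- The fractional part does not change along unit steps.
    have hfract := hH.eq_of_adj_eq (fun y => Int.fract (g y)) (by
      intro a b h
      rw [Int.fract_eq_fract]
      rcases (abs_eq zero_le_one).1 h.2 with h' | h'
      · exact ⟨1, by simpa using h'⟩
      · exact ⟨-1, by simpa using h'⟩) x v
    obtain ⟨n, hn⟩ := Int.fract_eq_fract.1 hfract
    exact ⟨n, by simpa [g] using hn⟩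
  choose f hf using hint
  have hfle : ∀ i j, G.Adj i j → |f i - f j| ≤ 1 := by
    intro i j h
    have h1 := hgle i j h
    have h2 := hgle j i h.symm
    rw [hf, hf] at h1 h2
    rw [abs_le]
    constructor
    · have : f j - f i ≤ 1 := by exact_mod_cast h2
      omega
    · exact_mod_cast h1
  have hHf : unitStepSubgraph G f = H := by
    ext i j
    simp only [unitStepSubgraph, H, hf]
    refine and_congr_right fun _ => ?_
    norm_cast
  have hfm : f ∈ facetLabelings G v := by
    refine ⟨?_, hfle, hHf ▸ hH⟩
    have : (f v : ℝ) = 0 := by rw [← hf]; simp [g]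
    exact_mod_cast this
  refine ⟨f, hfm, ?_⟩
  rw [hFl]
  ext x
  refine and_congr_right fun hx => ?_
  -- The two functionals may differ by a multiple of the coordinate sum, which vanishes on edge
  -- vectors.
  have heq : Set.EqOn (labelingFunctional f).toLinearMap l
      (Submodule.span ℝ (symmetricEdgePolytope G)) := by
    rw [span_symmetricEdgePolytope]
    refine LinearMap.eqOn_span ?_
    rintro _ ⟨i, j, -, rfl⟩
    rw [hg, hf, hf]
    exact labelingFunctional_single_sub f i j
  have : labelingFunctional f x = l x := heq (Submodule.subset_span hx)
  rw [this]

end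

theorem numFacets_symmetricEdgePolytope {V : Type*} [Finite V] {G : SimpleGraph V}
    (hG : G.Connected) (hV : 2 ≤ Nat.card V) (v : V) :
    numFacets (symmetricEdgePolytope G) = (facetLabelings G v).ncard := by
  have := Fintype.ofFinite V
  have : Nontrivial V := Finite.one_lt_card_iff_nontrivial.1 hV
  rw [← (labelingFace_injOn (G := G) v).ncard_image]
  unfold numFacets
  congr 1
  ext F
  constructor
  · intro hF
    exact hF.exists_labeling hG v
  · rintro ⟨f, hf, rfl⟩
    exact isFacet_labelingFace hf

/-! ### Iterated 1-sums and their labeling counts -/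

/-- 1-sums are invariant under isomorphism of all graphs involved. -/
theorem IsOneSum.congr {V V₁ V₂ W W₁ W₂ : Type*} {G : SimpleGraph V} {G₁ : SimpleGraph V₁}
    {G₂ : SimpleGraph V₂} {H : SimpleGraph W} {H₁ : SimpleGraph W₁} {H₂ : SimpleGraph W₂}
    (h : IsOneSum G G₁ G₂) (e : G ≃g H) (e₁ : G₁ ≃g H₁) (e₂ : G₂ ≃g H₂) : IsOneSum H H₁ H₂ := by
  obtain ⟨D⟩ := h.exists_data
  refine OneSumData.isOneSum
    { f₁ := e₁.symm.toEquiv.toEmbedding.trans (D.f₁.trans e.toEquiv.toEmbedding)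
      f₂ := e₂.symm.toEquiv.toEmbedding.trans (D.f₂.trans e.toEquiv.toEmbedding)
      v₁ := e₁ D.v₁
      v₂ := e₂ D.v₂
      glue := by simp [D.glue]
      r₁ := fun x => e₁ (D.r₁ (e.symm x))
      r₂ := fun x => e₂ (D.r₂ (e.symm x))
      r₁_f₁ := fun a => by simp [D.r₁_f₁]
      r₂_f₂ := fun a => by simp [D.r₂_f₂]
      r₁_f₂ := fun a => by simp [D.r₁_f₂]
      r₂_f₁ := fun a => by simp [D.r₂_f₁]
      cover := fun x => ?_
      adj_iff := fun x y => ?_ }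
  · rcases D.cover (e.symm x) with ⟨a, ha⟩ | ⟨a, ha⟩
    · exact Or.inl ⟨e₁ a, by simp [ha]⟩
    · exact Or.inr ⟨e₂ a, by simp [ha]⟩
  · rw [← e.symm.map_adj_iff, D.adj_iff]
    refine or_congr ⟨?_, ?_⟩ ⟨?_, ?_⟩
    · rintro ⟨a, b, h, ha, hb⟩
      exact ⟨e₁ a, e₁ b, e₁.map_adj_iff.2 h, by simp [ha], by simp [hb]⟩
    · rintro ⟨a, b, h, rfl, rfl⟩
      exact ⟨e₁.symm a, e₁.symm b, e₁.symm.map_adj_iff.2 h, by simp, by simp⟩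
    · rintro ⟨a, b, h, ha, hb⟩
      exact ⟨e₂ a, e₂ b, e₂.map_adj_iff.2 h, by simp [ha], by simp [hb]⟩
    · rintro ⟨a, b, h, rfl, rfl⟩
      exact ⟨e₂.symm a, e₂.symm b, e₂.symm.map_adj_iff.2 h, by simp, by simp⟩

/-- The first summand has a copy in the universe of the sum. -/
theorem OneSumData.exists_iso_left {V V₁ V₂ W : Type*} {G : SimpleGraph V} {G₁ : SimpleGraph V₁}
    {G₂ : SimpleGraph V₂} (D : OneSumData G G₁ G₂) (e : V ≃ W) :
    ∃ (S : Set W) (H : SimpleGraph S), Nonempty (G₁ ≃g H) :=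
  ⟨_, _, ⟨SimpleGraph.Iso.map
    (Equiv.ofInjective (fun a => e (D.f₁ a)) (e.injective.comp D.f₁.injective)) G₁⟩⟩

/-- The summands must share the universe of the sum, so they are replaced by copies on subsets of
the target vertex set. -/
theorem IsOneSumOf.iso.{u, w} {s : Multiset (Σ m : ℕ, SimpleGraph (Fin m))} {V : Type u}
    {G : SimpleGraph V} (h : IsOneSumOf s G) :
    ∀ {W : Type w} {H : SimpleGraph W}, (G ≃g H) → IsOneSumOf s H := by
  induction h with
  | single G K e => exact fun e' => .single _ _ ⟨e'.symm.trans e.some⟩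
  | oneSum G G₁ G₂ s t _ _ h ih₁ ih₂ =>
    intro W H e
    obtain ⟨D⟩ := h.exists_data
    obtain ⟨S₁, H₁, ⟨e₁⟩⟩ := D.exists_iso_left e.toEquiv
    obtain ⟨S₂, H₂, ⟨e₂⟩⟩ := D.swap.exists_iso_left e.toEquiv
    exact .oneSum H H₁ H₂ s t (ih₁ e₁) (ih₂ e₂) (h.congr e e₁ e₂)

theorem IsOneSum.isOneSumOf_add.{u, v, w} {V : Type u} {V₁ : Type v} {V₂ : Type w}
    {G : SimpleGraph V} {G₁ : SimpleGraph V₁} {G₂ : SimpleGraph V₂} (h : IsOneSum G G₁ G₂)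
    {s t : Multiset (Σ m : ℕ, SimpleGraph (Fin m))} (h₁ : IsOneSumOf s G₁)
    (h₂ : IsOneSumOf t G₂) : IsOneSumOf (s + t) G := by
  obtain ⟨D⟩ := h.exists_data
  obtain ⟨S₁, H₁, ⟨e₁⟩⟩ := D.exists_iso_left (Equiv.refl V)
  obtain ⟨S₂, H₂, ⟨e₂⟩⟩ := D.swap.exists_iso_left (Equiv.refl V)
  exact .oneSum G H₁ H₂ s t (h₁.iso e₁) (h₂.iso e₂) (h.congr SimpleGraph.Iso.refl e₁ e₂)

/-- A 1-sum of complete graphs on at least two vertices has `∏ (2 ^ m - 2)` facet labelings. -/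
theorem IsOneSumOf.ncard_facetLabelings {s : Multiset (Σ m : ℕ, SimpleGraph (Fin m))} {V : Type*}
    {G : SimpleGraph V} (h : IsOneSumOf s G)
    (hs : ∀ H ∈ s, ∃ m, 2 ≤ m ∧ H = completeOn m) (v : V) :
    (facetLabelings G v).ncard = (s.map fun H => 2 ^ H.1 - 2).prod := by
  induction h with
  | single G K e =>
    obtain ⟨m, hm, rfl⟩ := hs K (Multiset.mem_singleton_self K)
    have hm' : 2 ≤ Nat.card (Fin m) := by simpa using hm
    rw [ncard_facetLabelings_iso e.some v (e.some v), Multiset.map_singleton,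
      Multiset.prod_singleton]
    exact (ncard_facetLabelings_top hm' _).trans (by simp [completeOn])
  | oneSum G G₁ G₂ s t _ _ h ih₁ ih₂ =>
    obtain ⟨D⟩ := h.exists_data
    rw [D.ncard_facetLabelings v D.v₁ D.v₂,
      ih₁ (fun H hH => hs H (Multiset.mem_add.2 (Or.inl hH))),
      ih₂ (fun H hH => hs H (Multiset.mem_add.2 (Or.inr hH))), Multiset.map_add,
      Multiset.prod_add]

theorem IsOneSumOf.ncard_facetLabelings_triangles {k : ℕ} {V : Type*} {G : SimpleGraph V}
    (h : IsOneSumOf (Multiset.replicate k (completeOn 3)) G) (v : V) :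
    (facetLabelings G v).ncard = 6 ^ k := by
  rw [h.ncard_facetLabelings
    (fun H hH => ⟨3, by norm_num, Multiset.eq_of_mem_replicate hH⟩) v]
  simp [completeOn]

theorem IsOneSumOf.ncard_facetLabelings_triangles_add {k : ℕ} {V : Type*} {G : SimpleGraph V}
    (h : IsOneSumOf ({completeOn 4} + Multiset.replicate k (completeOn 3)) G) (v : V) :
    (facetLabelings G v).ncard = 14 * 6 ^ k := by
  rw [h.ncard_facetLabelings (fun H hH => ?_) v]
  · simp [completeOn]
  · rcases Multiset.mem_add.1 hH with hH | hH
    · exact ⟨4, by norm_num, Multiset.mem_singleton.1 hH⟩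
    · exact ⟨3, by norm_num, Multiset.eq_of_mem_replicate hH⟩

/-! ### Complete bipartite graphs and small 1-sums -/

/-- A complete bipartite graph with at least two vertices on both sides has no cut vertex. -/
theorem OneSumData.not_iso_completeBipartiteGraph {V V₁ V₂ α β : Type*} {G : SimpleGraph V}
    {G₁ : SimpleGraph V₁} {G₂ : SimpleGraph V₂} (D : OneSumData G G₁ G₂) [Nontrivial V₁]
    [Nontrivial V₂] [Nontrivial α] [Nontrivial β] :
    ¬ Nonempty (G ≃g completeBipartiteGraph α β) := by
  rintro ⟨e⟩
  obtain ⟨a, ha⟩ := exists_ne D.v₁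
  obtain ⟨b, hb⟩ := exists_ne D.v₂
  -- Vertices on different sides share at most the glued vertex as a neighbor, while nonadjacent
  -- vertices of the complete bipartite graph share a whole side, with at least two elements.
  have hno : ∀ w : V, w ≠ D.f₁ D.v₁ → G.Adj (D.f₁ a) w → ¬ G.Adj (D.f₂ b) w := by
    intro w hw h1 h2
    rcases D.cover w with ⟨c, rfl⟩ | ⟨c, rfl⟩
    · exact D.not_adj_f₁_f₂ (fun h => hw (h ▸ rfl)) hb h2.symm
    · exact D.not_adj_f₁_f₂ ha (fun h => hw (by rw [h, D.glue])) h1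
  have hadj := D.not_adj_f₁_f₂ ha hb
  rw [← e.map_adj_iff] at hadj
  have hno' : ∀ w, w ≠ e (D.f₁ D.v₁) → (completeBipartiteGraph α β).Adj (e (D.f₁ a)) w →
      ¬ (completeBipartiteGraph α β).Adj (e (D.f₂ b)) w := by
    intro w hw h1 h2
    refine hno (e.symm w) (fun h => hw (by rw [← h]; simp)) ?_ ?_
    · rw [← e.map_adj_iff]
      simpa using h1
    · rw [← e.map_adj_iff]
      simpa using h2
  generalize e (D.f₁ a) = x at *
  generalize e (D.f₂ b) = y at *
  generalize e (D.f₁ D.v₁) = z at *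
  rcases x with x | x <;> rcases y with y | y
  · obtain ⟨w, hw⟩ : ∃ w : β, (Sum.inr w : α ⊕ β) ≠ z := by
      rcases z with z | z
      · exact ⟨Classical.arbitrary β, by simp⟩
      · obtain ⟨w, hw⟩ := exists_ne z
        exact ⟨w, by simpa using hw⟩
    exact hno' _ hw (by simp) (by simp)
  · simp at hadj
  · simp at hadj
  · obtain ⟨w, hw⟩ : ∃ w : α, (Sum.inl w : α ⊕ β) ≠ z := by
      rcases z with z | z
      · obtain ⟨w, hw⟩ := exists_ne z
        exact ⟨w, by simpa using hw⟩
      · exact ⟨Classical.arbitrary α, by simp⟩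
    exact hno' _ hw (by simp) (by simp)

theorem SimpleGraph.Connected.eq_top_of_card_eq_two {V : Type*} {G : SimpleGraph V}
    (hG : G.Connected) (hV : Nat.card V = 2) : G = ⊤ := by
  have : Finite V := Nat.finite_of_card_ne_zero (by omega)
  have : Nontrivial V := Finite.one_lt_card_iff_nontrivial.1 (by omega)
  obtain ⟨x, y, hxy, hu⟩ := Nat.card_eq_two_iff.1 hV
  have hcov : ∀ z, z = x ∨ z = y := fun z => by
    have : z ∈ ({x, y} : Set V) := hu ▸ trivial
    simpa using this
  obtain ⟨w, hw⟩ := hG.preconnected.exists_adj_of_nontrivial x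
  have hadj : G.Adj x y := by
    rcases hcov w with rfl | rfl
    · exact absurd hw G.irrefl
    · exact hw
  ext a b
  rw [SimpleGraph.top_adj]
  refine ⟨SimpleGraph.Adj.ne, fun hab => ?_⟩
  rcases hcov a with rfl | rfl <;> rcases hcov b with rfl | rfl
  exacts [absurd rfl hab, hadj, hadj.symm, absurd rfl hab]

/-- The 1-sum of two edges is a path with three vertices. -/
theorem OneSumData.nonempty_iso_of_card_eq_two {V V₁ V₂ : Type*} {G : SimpleGraph V}
    {G₁ : SimpleGraph V₁} {G₂ : SimpleGraph V₂} (D : OneSumData G G₁ G₂) (hG₁ : G₁ = ⊤)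
    (hG₂ : G₂ = ⊤) (h₁ : Nat.card V₁ = 2) (h₂ : Nat.card V₂ = 2) :
    Nonempty (G ≃g completeBipartiteGraph (Fin 1) (Fin 2)) := by
  subst hG₁ hG₂
  obtain ⟨a, ha, hau⟩ := (Nat.card_eq_two_iff' D.v₁).1 h₁
  obtain ⟨b, hb, hbu⟩ := (Nat.card_eq_two_iff' D.v₂).1 h₂
  have hab : D.f₁ a ≠ D.f₂ b := fun h => ha (D.eq_of_f₁_eq_f₂ h).1
  have hva : D.f₁ D.v₁ ≠ D.f₁ a := fun h => ha (D.f₁.injective h).symm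
  have hvb : D.f₁ D.v₁ ≠ D.f₂ b := by
    rw [D.glue]
    exact fun h => hb (D.f₂.injective h).symm
  have adj1 : G.Adj (D.f₁ D.v₁) (D.f₁ a) := D.adj_f₁.2 ha.symm
  have adj2 : G.Adj (D.f₁ D.v₁) (D.f₂ b) := by
    rw [D.glue]
    exact D.adj_f₂.2 hb.symm
  have nadj : ¬ G.Adj (D.f₁ a) (D.f₂ b) := D.not_adj_f₁_f₂ ha hb
  have hcov : ∀ x, x = D.f₁ D.v₁ ∨ x = D.f₁ a ∨ x = D.f₂ b := by
    intro x
    rcases D.cover x with ⟨c, rfl⟩ | ⟨c, rfl⟩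
    · by_cases hc : c = D.v₁
      · exact Or.inl (by rw [hc])
      · exact Or.inr (Or.inl (by rw [hau c hc]))
    · by_cases hc : c = D.v₂
      · exact Or.inl (by rw [hc, D.glue])
      · exact Or.inr (Or.inr (by rw [hbu c hc]))
  generalize D.f₁ D.v₁ = z at *
  generalize D.f₁ a = x at *
  generalize D.f₂ b = y at *
  let g : Fin 1 ⊕ Fin 2 → V := Sum.elim (fun _ => z) ![x, y]
  have hg : Function.Bijective g := by
    constructor
    · rintro (i | i) (j | j) h
      · rw [Subsingleton.elim i j]
      · fin_cases j <;> simp_all [g]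
      · fin_cases i <;> simp_all [g]
      · fin_cases i <;> fin_cases j <;> simp_all [g]
    · intro w
      rcases hcov w with rfl | rfl | rfl
      exacts [⟨Sum.inl 0, rfl⟩, ⟨Sum.inr 0, rfl⟩, ⟨Sum.inr 1, rfl⟩]
  refine ⟨(SimpleGraph.Iso.symm ⟨Equiv.ofBijective g hg, ?_⟩)⟩
  rintro (i | i) (j | j)
  · simp [g]
  · fin_cases j <;> simp [g, adj1, adj2]
  · fin_cases i <;> simp [g, adj1.symm, adj2.symm]
  · have nadj' : ¬ G.Adj y x := fun h => nadj h.symm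
    fin_cases i <;> fin_cases j <;> simp [g, nadj, nadj']

/-! ### Bounds by parity of the orders -/

theorem satisfiesBraunBruegge_of_card_odd {V : Type*} {G : SimpleGraph V} {k : ℕ}
    (hV : Nat.card V = 2 * k + 1)
    (h : 3 * 2 ^ k - 2 ≤ numFacets (symmetricEdgePolytope G) ∧
      numFacets (symmetricEdgePolytope G) ≤ 6 ^ k ∧
      (numFacets (symmetricEdgePolytope G) = 3 * 2 ^ k - 2 ↔
        Nonempty (G ≃g completeBipartiteGraph (Fin k) (Fin (k + 1)))) ∧
      (numFacets (symmetricEdgePolytope G) = 6 ^ k ↔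
        IsOneSumOf (Multiset.replicate k (completeOn 3)) G)) :
    SatisfiesBraunBruegge G := by
  intro _
  refine ⟨fun _ => ?_, fun he => ?_⟩
  · have e1 : (Nat.card V - 1) / 2 = k := by omega
    have e2 : (Nat.card V + 1) / 2 = k + 1 := by omega
    rw [e1, e2]
    exact h
  · exact absurd he (Nat.not_even_iff_odd.2 ⟨k, hV⟩)

theorem satisfiesBraunBruegge_of_card_even {V : Type*} {G : SimpleGraph V} {k : ℕ}
    (hV : Nat.card V = 2 * k)
    (h : 2 ^ (k + 1) - 2 ≤ numFacets (symmetricEdgePolytope G) ∧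
      numFacets (symmetricEdgePolytope G) ≤ 14 * 6 ^ (k - 2) ∧
      (numFacets (symmetricEdgePolytope G) = 2 ^ (k + 1) - 2 ↔
        Nonempty (G ≃g completeBipartiteGraph (Fin k) (Fin k))) ∧
      (numFacets (symmetricEdgePolytope G) = 14 * 6 ^ (k - 2) ↔
        IsOneSumOf ({completeOn 4} + Multiset.replicate (k - 2) (completeOn 3)) G)) :
    SatisfiesBraunBruegge G := by
  intro _
  refine ⟨fun ho => ?_, fun _ => ?_⟩
  · exact absurd ho (Nat.not_odd_iff_even.2 ⟨k, by omega⟩)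
  · have e1 : Nat.card V / 2 = k := by omega
    rw [e1]
    exact h

theorem SatisfiesBraunBruegge.of_card_odd {V : Type*} [Finite V] {G : SimpleGraph V} {a : ℕ}
    (h : SatisfiesBraunBruegge G) (hG : G.Connected) (hV : Nat.card V = 2 * a + 1) (ha : 1 ≤ a)
    (v : V) :
    3 * 2 ^ a ≤ (facetLabelings G v).ncard + 2 ∧ (facetLabelings G v).ncard ≤ 6 ^ a ∧
      ((facetLabelings G v).ncard = 6 ^ a →
        IsOneSumOf (Multiset.replicate a (completeOn 3)) G) := by
  have h' := (h (by omega)).1 ⟨a, hV⟩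
  rw [hV, numFacets_symmetricEdgePolytope hG (by omega) v] at h'
  have e1 : (2 * a + 1 - 1) / 2 = a := by omega
  rw [e1] at h'
  exact ⟨by omega, h'.2.1, h'.2.2.2.1⟩

theorem SatisfiesBraunBruegge.of_card_even {V : Type*} [Finite V] {G : SimpleGraph V} {b : ℕ}
    (h : SatisfiesBraunBruegge G) (hG : G.Connected) (hV : Nat.card V = 2 * b) (hb : 2 ≤ b)
    (v : V) :
    2 * 2 ^ b ≤ (facetLabelings G v).ncard + 2 ∧
      (facetLabelings G v).ncard ≤ 14 * 6 ^ (b - 2) ∧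
      ((facetLabelings G v).ncard = 14 * 6 ^ (b - 2) →
        IsOneSumOf ({completeOn 4} + Multiset.replicate (b - 2) (completeOn 3)) G) := by
  have h' := (h (by omega)).2 ⟨b, by omega⟩
  rw [hV, numFacets_symmetricEdgePolytope hG (by omega) v] at h'
  have e1 : 2 * b / 2 = b := by omega
  rw [e1, pow_succ'] at h'
  exact ⟨by omega, h'.2.1, h'.2.2.2.1⟩

theorem ncard_facetLabelings_of_card_eq_two {V : Type*} {G : SimpleGraph V} (hG : G.Connected)
    (hV : Nat.card V = 2) (v : V) : (facetLabelings G v).ncard = 2 := by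
  have : Finite V := Nat.finite_of_card_ne_zero (by omega)
  rw [hG.eq_top_of_card_eq_two hV, ncard_facetLabelings_top hV.ge, hV]
  norm_num

/-- The bounds for graphs of even order, including order two. -/
theorem SatisfiesBraunBruegge.bounds_of_card_even {V : Type*} [Finite V] {G : SimpleGraph V}
    {b : ℕ} (h : SatisfiesBraunBruegge G) (hG : G.Connected) (hV : Nat.card V = 2 * b)
    (hb : 1 ≤ b) (v : V) :
    2 * 2 ^ b ≤ (facetLabelings G v).ncard + 2 ∧
      36 * (facetLabelings G v).ncard ≤ 14 * 6 ^ b := by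
  -- The factor 36 avoids the exponent `b - 2`, which truncates at `b = 1`; there the bound reads 72
  -- ≤ 84.
  rcases hb.eq_or_lt with rfl | hb
  · rw [ncard_facetLabelings_of_card_eq_two hG hV]
    norm_num
  · obtain ⟨h1, h2, -⟩ := h.of_card_even hG hV hb v
    obtain ⟨c, rfl⟩ := Nat.exists_eq_add_of_le' hb
    rw [Nat.add_sub_cancel] at h2
    refine ⟨h1, ?_⟩
    rw [pow_add]
    omega

/-- Turns the lower bounds into polynomials in `x` with nonnegative coefficients, free of
subtraction. -/
theorem exists_two_pow_eq_add_two {a : ℕ} (ha : 1 ≤ a) : ∃ x, 2 ^ a = x + 2 :=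
  Nat.exists_eq_add_of_le' (Nat.le_self_pow (by omega) 2)

theorem eq_and_eq_of_mul_eq_mul {a b c d : ℕ} (hab : a ≤ c) (hbd : b ≤ d) (h : a * b = c * d)
    (hc : 0 < c) (hd : 0 < d) : a = c ∧ b = d := by
  constructor
  · refine le_antisymm hab (Nat.le_of_mul_le_mul_right ?_ hd)
    rw [← h]
    exact Nat.mul_le_mul_left a hbd
  · refine le_antisymm hbd (Nat.le_of_mul_le_mul_left ?_ hc)
    rw [← h]
    exact Nat.mul_le_mul_right b hab

theorem SatisfiesBraunBruegge.iso {V W : Type*} [Finite V] {G : SimpleGraph V}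
    {H : SimpleGraph W} (h : SatisfiesBraunBruegge G) (hG : G.Connected) (e : G ≃g H) :
    SatisfiesBraunBruegge H := by
  have : Finite W := Finite.of_equiv V e.toEquiv
  obtain ⟨v⟩ := hG.nonempty
  have hc : Nat.card W = Nat.card V := (Nat.card_congr e.toEquiv).symm
  intro hn
  have hN : numFacets (symmetricEdgePolytope H) = numFacets (symmetricEdgePolytope G) := by
    rw [numFacets_symmetricEdgePolytope hG (by omega) v, ncard_facetLabelings_iso e v (e v)]
    exact numFacets_symmetricEdgePolytope (e.connected_iff.1 hG) (by omega) (e v)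
  have hiso : ∀ {U : Type} (K : SimpleGraph U), Nonempty (H ≃g K) ↔ Nonempty (G ≃g K) :=
    fun K => ⟨fun ⟨f⟩ => ⟨e.trans f⟩, fun ⟨f⟩ => ⟨e.symm.trans f⟩⟩
  have hsum : ∀ s, IsOneSumOf s H ↔ IsOneSumOf s G := fun s =>
    ⟨fun f => f.iso e.symm, fun f => f.iso e⟩
  rw [hc, hN]
  simp only [hiso, hsum]
  exact h (by omega)

section

variable {V V₁ V₂ : Type*} [Finite V] [Finite V₁] [Finite V₂] {G : SimpleGraph V}
  {G₁ : SimpleGraph V₁} {G₂ : SimpleGraph V₂}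

theorem OneSumData.satisfiesBraunBruegge_odd_odd (D : OneSumData G G₁ G₂) (hG₁ : G₁.Connected)
    (hG₂ : G₂.Connected) (h₁ : SatisfiesBraunBruegge G₁) (h₂ : SatisfiesBraunBruegge G₂) {a b : ℕ}
    (ha : 1 ≤ a) (hb : 1 ≤ b) (hV₁ : Nat.card V₁ = 2 * a + 1) (hV₂ : Nat.card V₂ = 2 * b + 1) :
    SatisfiesBraunBruegge G := by
  have hcard := D.card_add_one
  have : Nontrivial V₁ := Finite.one_lt_card_iff_nontrivial.1 (by omega)
  have : Nontrivial V₂ := Finite.one_lt_card_iff_nontrivial.1 (by omega)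
  obtain ⟨l₁, u₁, m₁⟩ := h₁.of_card_odd hG₁ hV₁ ha D.v₁
  obtain ⟨l₂, u₂, m₂⟩ := h₂.of_card_odd hG₂ hV₂ hb D.v₂
  have hprod := D.ncard_facetLabelings (D.f₁ D.v₁) D.v₁ D.v₂
  refine satisfiesBraunBruegge_of_card_odd (k := a + b) (by omega) ?_
  rw [numFacets_symmetricEdgePolytope (D.connected_iff.2 ⟨hG₁, hG₂⟩) (by omega) (D.f₁ D.v₁)]
  have hlow : 3 * 2 ^ (a + b) < (facetLabelings G (D.f₁ D.v₁)).ncard + 2 := by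
    obtain ⟨x, hx⟩ := exists_two_pow_eq_add_two ha
    obtain ⟨y, hy⟩ := exists_two_pow_eq_add_two hb
    rw [hx] at l₁
    rw [hy] at l₂
    have := Nat.mul_le_mul (show 3 * x + 4 ≤ (facetLabelings G₁ D.v₁).ncard by omega)
      (show 3 * y + 4 ≤ (facetLabelings G₂ D.v₂).ncard by omega)
    rw [pow_add, hprod, hx, hy]
    nlinarith
  refine ⟨by omega, ?_, ⟨fun h => by have := Nat.two_pow_pos (a + b); omega, fun h => ?_⟩, fun h => ?_,
    fun h => h.ncard_facetLabelings_triangles _⟩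
  · rw [hprod, pow_add]
    exact Nat.mul_le_mul u₁ u₂
  · have : Nontrivial (Fin (a + b)) := Fin.nontrivial_iff_two_le.2 (by omega)
    have : Nontrivial (Fin (a + b + 1)) := Fin.nontrivial_iff_two_le.2 (by omega)
    exact absurd h D.not_iso_completeBipartiteGraph
  · rw [hprod, pow_add] at h
    obtain ⟨e₁, e₂⟩ := eq_and_eq_of_mul_eq_mul u₁ u₂ h (by positivity) (by positivity)
    rw [Multiset.replicate_add]
    exact D.isOneSum.isOneSumOf_add (m₁ e₁) (m₂ e₂)

theorem OneSumData.satisfiesBraunBruegge_even_even (D : OneSumData G G₁ G₂) (hG₁ : G₁.Connected)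
    (hG₂ : G₂.Connected) (h₁ : SatisfiesBraunBruegge G₁) (h₂ : SatisfiesBraunBruegge G₂) {a b : ℕ}
    (ha : 1 ≤ a) (hb : 1 ≤ b) (hV₁ : Nat.card V₁ = 2 * a) (hV₂ : Nat.card V₂ = 2 * b) :
    SatisfiesBraunBruegge G := by
  have hcard := D.card_add_one
  have : Nontrivial V₁ := Finite.one_lt_card_iff_nontrivial.1 (by omega)
  have : Nontrivial V₂ := Finite.one_lt_card_iff_nontrivial.1 (by omega)
  obtain ⟨l₁, u₁⟩ := h₁.bounds_of_card_even hG₁ hV₁ ha D.v₁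
  obtain ⟨l₂, u₂⟩ := h₂.bounds_of_card_even hG₂ hV₂ hb D.v₂
  have hprod := D.ncard_facetLabelings (D.f₁ D.v₁) D.v₁ D.v₂
  obtain ⟨k, hk⟩ : ∃ k, a + b = k + 1 := ⟨a + b - 1, by omega⟩
  refine satisfiesBraunBruegge_of_card_odd (k := k) (by omega) ?_
  rw [numFacets_symmetricEdgePolytope (D.connected_iff.2 ⟨hG₁, hG₂⟩) (by omega) (D.f₁ D.v₁)]
  -- The bounds multiply to `36² N ≤ 14² · 6 · 6 ^ k`, and 1176 < 1296.
  have hup : (facetLabelings G (D.f₁ D.v₁)).ncard < 6 ^ k := by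
    have h6 : (6 : ℕ) ^ a * 6 ^ b = 6 * 6 ^ k := by rw [← pow_add, hk, pow_succ']
    have hpos : 0 < (6 : ℕ) ^ k := by positivity
    have := Nat.mul_le_mul u₁ u₂
    rw [hprod]
    nlinarith
  have hup_iff : (facetLabelings G (D.f₁ D.v₁)).ncard = 6 ^ k ↔
      IsOneSumOf (Multiset.replicate k (completeOn 3)) G :=
    ⟨fun h => absurd h hup.ne, fun h => h.ncard_facetLabelings_triangles _⟩
  have h2 : (2 : ℕ) ^ a * 2 ^ b = 2 * 2 ^ k := by rw [← pow_add, hk, pow_succ']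
  by_cases hab : a = 1 ∧ b = 1
  · obtain ⟨rfl, rfl⟩ := hab
    obtain rfl : k = 1 := by omega
    have hN : (facetLabelings G (D.f₁ D.v₁)).ncard = 4 := by
      rw [hprod, ncard_facetLabelings_of_card_eq_two hG₁ hV₁,
        ncard_facetLabelings_of_card_eq_two hG₂ hV₂]
    refine ⟨by rw [hN]; norm_num, hup.le, ⟨fun _ => ?_, fun _ => hN⟩, hup_iff⟩
    exact D.nonempty_iso_of_card_eq_two (hG₁.eq_top_of_card_eq_two hV₁)
      (hG₂.eq_top_of_card_eq_two hV₂) hV₁ hV₂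
  -- Twice the gap between `(2x+2)(2y+2)` and `3 * 2 ^ k - 2` is `5xy + 2x + 2y`, which is 0 only
  -- for `x = y = 0`, that is, for two edges.
  · have hlow : 3 * 2 ^ k < (facetLabelings G (D.f₁ D.v₁)).ncard + 2 := by
      obtain ⟨x, hx⟩ := exists_two_pow_eq_add_two ha
      obtain ⟨y, hy⟩ := exists_two_pow_eq_add_two hb
      have hxy : 0 < x + y := by
        by_contra! h0
        have hpow : ∀ c, 2 ^ c = 2 → c = 1 := fun c hc =>
          Nat.pow_right_injective le_rfl (hc.trans (pow_one 2).symm)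
        exact hab ⟨hpow a (by omega), hpow b (by omega)⟩
      rw [hx] at l₁
      rw [hy] at l₂
      have := Nat.mul_le_mul (show 2 * x + 2 ≤ (facetLabelings G₁ D.v₁).ncard by omega)
        (show 2 * y + 2 ≤ (facetLabelings G₂ D.v₂).ncard by omega)
      rw [hx, hy] at h2
      rw [hprod]
      nlinarith
    refine ⟨by omega, hup.le, ⟨fun h => by have := Nat.two_pow_pos k; omega, fun h => ?_⟩, hup_iff⟩
    have : Nontrivial (Fin k) := Fin.nontrivial_iff_two_le.2 (by omega)
    have : Nontrivial (Fin (k + 1)) := Fin.nontrivial_iff_two_le.2 (by omega)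
    exact absurd h D.not_iso_completeBipartiteGraph

theorem OneSumData.satisfiesBraunBruegge_odd_even (D : OneSumData G G₁ G₂) (hG₁ : G₁.Connected)
    (hG₂ : G₂.Connected) (h₁ : SatisfiesBraunBruegge G₁) (h₂ : SatisfiesBraunBruegge G₂) {a b : ℕ}
    (ha : 1 ≤ a) (hb : 1 ≤ b) (hV₁ : Nat.card V₁ = 2 * a + 1) (hV₂ : Nat.card V₂ = 2 * b) :
    SatisfiesBraunBruegge G := by
  have hcard := D.card_add_one
  have : Nontrivial V₁ := Finite.one_lt_card_iff_nontrivial.1 (by omega)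
  have : Nontrivial V₂ := Finite.one_lt_card_iff_nontrivial.1 (by omega)
  obtain ⟨l₁, u₁, m₁⟩ := h₁.of_card_odd hG₁ hV₁ ha D.v₁
  obtain ⟨l₂, -⟩ := h₂.bounds_of_card_even hG₂ hV₂ hb D.v₂
  have hprod := D.ncard_facetLabelings (D.f₁ D.v₁) D.v₁ D.v₂
  refine satisfiesBraunBruegge_of_card_even (k := a + b) (by omega) ?_
  rw [numFacets_symmetricEdgePolytope (D.connected_iff.2 ⟨hG₁, hG₂⟩) (by omega) (D.f₁ D.v₁)]
  have hlow : 2 ^ (a + b + 1) < (facetLabelings G (D.f₁ D.v₁)).ncard + 2 := by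
    obtain ⟨x, hx⟩ := exists_two_pow_eq_add_two ha
    obtain ⟨y, hy⟩ := exists_two_pow_eq_add_two hb
    rw [hx] at l₁
    rw [hy] at l₂
    have := Nat.mul_le_mul (show 3 * x + 4 ≤ (facetLabelings G₁ D.v₁).ncard by omega)
        (show 2 * y + 2 ≤ (facetLabelings G₂ D.v₂).ncard by omega)
    rw [pow_succ, pow_add, hprod, hx, hy]
    nlinarith
  have hup : (facetLabelings G (D.f₁ D.v₁)).ncard ≤ 14 * 6 ^ (a + b - 2) ∧
      ((facetLabelings G (D.f₁ D.v₁)).ncard = 14 * 6 ^ (a + b - 2) →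
        IsOneSumOf ({completeOn 4} + Multiset.replicate (a + b - 2) (completeOn 3)) G) := by
    rcases hb.eq_or_lt with rfl | hb
    · obtain ⟨c, rfl⟩ := Nat.exists_eq_add_of_le' ha
      have hpos : 0 < (6 : ℕ) ^ c := by positivity
      -- An attached edge only doubles the count: `2 * 6 ^ (c + 1) = 12 * 6 ^ c`.
      have hlt : (facetLabelings G (D.f₁ D.v₁)).ncard < 14 * 6 ^ (c + 1 + 1 - 2) := by
        rw [hprod, ncard_facetLabelings_of_card_eq_two hG₂ hV₂]
        rw [pow_succ] at u₁
        simp only [Nat.reduceSubDiff]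
        omega
      exact ⟨hlt.le, fun h => absurd h hlt.ne⟩
    · obtain ⟨-, u₂, m₂⟩ := h₂.of_card_even hG₂ hV₂ hb D.v₂
      have hexp : 14 * 6 ^ (a + b - 2) = 6 ^ a * (14 * 6 ^ (b - 2)) := by
        rw [Nat.add_sub_assoc hb, pow_add]
        ring
      rw [hexp, hprod]
      refine ⟨Nat.mul_le_mul u₁ u₂, fun h => ?_⟩
      obtain ⟨e₁, e₂⟩ := eq_and_eq_of_mul_eq_mul u₁ u₂ h (by positivity) (by positivity)
      rw [Nat.add_sub_assoc hb, Multiset.replicate_add, add_left_comm]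
      exact D.isOneSum.isOneSumOf_add (m₁ e₁) (m₂ e₂)
  refine ⟨by omega, hup.1, ⟨fun h => by have := Nat.two_pow_pos (a + b + 1); omega, fun h => ?_⟩, hup.2,
    fun h => h.ncard_facetLabelings_triangles_add _⟩
  have : Nontrivial (Fin (a + b)) := Fin.nontrivial_iff_two_le.2 (by omega)
  exact absurd h D.not_iso_completeBipartiteGraph

end

theorem proposition2p11 {V V₁ V₂ : Type*} [Finite V] [Finite V₁] [Finite V₂]
    (G : SimpleGraph V) (G₁ : SimpleGraph V₁) (G₂ : SimpleGraph V₂)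
    (hG₁ : G₁.Connected) (hG₂ : G₂.Connected) (hG : IsOneSum G G₁ G₂)
    (h₁ : SatisfiesBraunBruegge G₁) (h₂ : SatisfiesBraunBruegge G₂) :
    SatisfiesBraunBruegge G := by
  obtain ⟨D⟩ := hG.exists_data
  have hpos₁ : 0 < Nat.card V₁ := Nat.card_pos_iff.2 ⟨⟨D.v₁⟩, inferInstance⟩
  have hpos₂ : 0 < Nat.card V₂ := Nat.card_pos_iff.2 ⟨⟨D.v₂⟩, inferInstance⟩
  rcases Nat.even_or_odd' (Nat.card V₁) with ⟨a, ha | ha⟩ <;>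
    rcases Nat.even_or_odd' (Nat.card V₂) with ⟨b, hb | hb⟩
  · exact D.satisfiesBraunBruegge_even_even hG₁ hG₂ h₁ h₂ (by omega) (by omega) ha hb
  · rcases Nat.eq_zero_or_pos b with rfl | hb'
    · have : Subsingleton V₂ := (Nat.card_eq_one_iff_unique.1 hb).1
      exact h₁.iso hG₁ D.swap.nonempty_iso_of_subsingleton.some
    · exact D.swap.satisfiesBraunBruegge_odd_even hG₂ hG₁ h₂ h₁ hb' (by omega) hb ha
  · rcases Nat.eq_zero_or_pos a with rfl | ha'
    · have : Subsingleton V₁ := (Nat.card_eq_one_iff_unique.1 ha).1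
      exact h₂.iso hG₂ D.nonempty_iso_of_subsingleton.some
    · exact D.satisfiesBraunBruegge_odd_even hG₁ hG₂ h₁ h₂ ha' (by omega) ha hb
  · rcases Nat.eq_zero_or_pos a with rfl | ha'
    · have : Subsingleton V₁ := (Nat.card_eq_one_iff_unique.1 ha).1
      exact h₂.iso hG₂ D.nonempty_iso_of_subsingleton.some
    · rcases Nat.eq_zero_or_pos b with rfl | hb'
      · have : Subsingleton V₂ := (Nat.card_eq_one_iff_unique.1 hb).1
        exact h₁.iso hG₁ D.swap.nonempty_iso_of_subsingleton.some
      · exact D.satisfiesBraunBruegge_odd_odd hG₁ hG₂ h₁ h₂ ha' hb' ha hb
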